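/- A \emph{pasture} is a commutative multiplicative monoid $P$ with absorbing element $0$ such that $P^\times=P\setminus\{0\}$, together with a map $a\mapsto -a$ and a nonempty subset $N_P$ (the null set) of $\mathrm{Sym}_3(P)=P^3/S_3$, whose elements are written $a+b+c$, such that $N_P$ is closed under multiplication by elements of $P$, and $a+b+0\in N_P$ if and only if $b=-a$. We write $a+b-c$ for $a+b+(-c)$. Morphisms are maps preserving $0$, $1$, products and null sets. Let $\mathbb F_1^\pm=\{0,1,-1\}$ with null set $\{0+0+0,\ 1+(-1)+0\}$. Write $\mathbb F_1^\pm\langle x_i\rangle$ for the pasture whose unit group is the product of $\{\pm1\}$ with the free abelian group on the $x_i$ and whose null set consists of the multiples of the elements of $N_{\mathbb F_1^\pm}$. For a family of formal sums $a_j+b_j+c_j$ with $a_j,b_j$ units, the quotient $P/\!\!/\langle a_j+b_j+c_j\rangle$ is obtained from $P$ by identifying $da_j$ with $-db_j$ for all $d\in P$ whenever $c_j=0$, and by adding all multiples of the $a_j+b_j+c_j$ to the (image of the) null set. Let $M$ be a matroid of rank $r$ on a finite set $E$. Its extended Tutte group is the abelian group generated by $-1$ and symbols $T_{\mathbf I}$,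 for all $\mathbf I\in E^r$ whose underlying set is a basis, subject to the relations $(-1)^2=1$; $T_{\sigma(\mathbf I)}=\mathrm{sign}(\sigma)\,T_{\mathbf I}$ for $\sigma\in S_r$; and $T_{\mathbf Jac}T_{\mathbf Jbd}=T_{\mathbf Jad}T_{\mathbf Jbc}$ whenever $\mathbf J\in E^{r-2}$ and $a,b,c,d\in E$ are such that $Jac,Jad,Jbc,Jbd$ are bases, but $Jab$ and $Jcd$ are not both bases. The Tutte group is the subgroup generated by $-1$ and all quotients $T_{\mathbf I}/T_{\mathbf J}$. The inner Tutte group $\mathbb T_M^{(0)}$ is the subgroup of the Tutte group of elements of multidegree zero, where $-1$ has multidegree $0$ and $T_{\mathbf I}$ has as its multidegree the indicator vector in $\mathbb Z^E$ of the set underlying $\mathbf I$. The \emph{foundation} $F_M$ of $M$ is the pasture with unit group $F_M^\times=\mathbb T_M^{(0)}$ whose null set is generated by (that is, consists of the multiples of $1+(-1)+0$ and of) the elements $$\frac{T_{\mathbf Jac}T_{\mathbf Jbd}}{T_{\mathbf Jad}T_{\mathbf Jbc}}+\frac{T_{\mathbf Jab}T_{\mathbf Jcd}}{T_{\mathbf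 Jad}T_{\mathbf Jcb}}-1$$ for all $\mathbf J\in E^{r-2}$ and $a,b,c,d\in E$ such that $Jab,Jac,Jad,Jbc,Jbd,Jcd$ are all bases of $M$. Let $U^r_n$ be the uniform matroid of rank $r$ on $n$ elements, and let $$\mathbb V=\mathbb F_1^\pm\langle x_1,\dots,x_5\rangle/\!\!/\langle x_i+x_{i-1}x_{i+1}-1\mid i=1,\dots,5\rangle,$$ with indices read modulo $5$. Then the foundation of $U^2_5$ is isomorphic to $\mathbb V$, and the foundation of $U^3_5$ is isomorphic to $\mathbb V$. -/

import Mathlib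

open CategoryTheory

universe u

/-- The class `a + b + c` of `(a, b, c)` in `Sym₃(A) = A³ / S₃`. -/
def formalSum {A : Type u} (a b c : A) : Sym A 3 := a ::ₛ b ::ₛ c ::ₛ Sym.nil

theorem formalSum_map {A B : Type u} (f : A → B) (a b c : A) :
    (formalSum a b c).map f = formalSum (f a) (f b) (f c) := rfl

/-- A pasture: a commutative pointed monoid in which exactly the nonzero elements are invertible,
with a map `a ↦ -a` and a null set in `Sym₃`. (The null set is nonempty and `a ↦ -a` is an
involution by `null_zero_iff`.) -/
structure Pasture where
  carrier : Type u
  [str : CommGroupWithZero carrier]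
  neg : carrier → carrier
  null : Set (Sym carrier 3)
  null_smul : ∀ t ∈ null, ∀ d : carrier, t.map (fun a => d * a) ∈ null
  null_zero_iff : ∀ a b : carrier, formalSum a b 0 ∈ null ↔ b = neg a

namespace Pasture

instance : CoeSort Pasture.{u} (Type u) := ⟨carrier⟩

instance (P : Pasture.{u}) : CommGroupWithZero P := P.str

instance (P : Pasture.{u}) : Neg P := ⟨P.neg⟩

/-- A morphism of pastures: a map that preserves `0`, `1` and products, and maps the null set into
the null set. -/
@[ext]
structure Hom (P Q : Pasture.{u}) where
  toHom : P →*₀ Q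
  map_null : ∀ t ∈ P.null, t.map toHom ∈ Q.null

/-- The category of pastures. -/
instance : Category Pasture.{u} where
  Hom P Q := Hom P Q
  id P := ⟨MonoidWithZeroHom.id P, fun t ht => by
    have : t.map (MonoidWithZeroHom.id P) = t := Sym.map_id t
    rwa [this]⟩
  comp f g := ⟨g.toHom.comp f.toHom, fun t ht => by
    have : t.map (g.toHom.comp f.toHom) = (t.map f.toHom).map g.toHom :=
      (Sym.map_map g.toHom f.toHom t).symm
    rw [this]
    exact g.map_null _ (f.map_null _ ht)⟩

theorem neg_involutive (P : Pasture.{u}) (a : P) : -(-a) = a := by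
  refine ((P.null_zero_iff (-a) a).1 ?_).symm
  have h := (P.null_zero_iff a (-a)).2 rfl
  rwa [formalSum, Sym.cons_swap] at h

theorem neg_eq_mul (P : Pasture.{u}) (a : P) : -a = -1 * a := by
  have h := P.null_smul _ ((P.null_zero_iff 1 (-1)).2 rfl) a
  have h2 : formalSum a (a * -1) 0 ∈ P.null := by simpa [formalSum_map] using h
  rw [mul_comm]
  exact ((P.null_zero_iff a (a * -1)).1 h2).symm

theorem neg_one_mul_neg_one (P : Pasture.{u}) : (-1 : P) * -1 = 1 := by
  rw [← neg_eq_mul, neg_involutive]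

/-- `-1` as a unit. -/
def negOne (P : Pasture.{u}) : Pˣ :=
  ⟨-1, -1, P.neg_one_mul_neg_one, P.neg_one_mul_neg_one⟩

/-- For an abelian group `G`, an element `ε` with `ε² = 1` and a set `R` of formal sums, the
pasture `G ∪ {0}` with `-a = ε a` whose null set is generated by `R`, i.e. consists of all
`d·1 + d·ε + d·0` and all `d·a + d·b + d·c` with `a + b + c` in `R`. The sums in `R` that involve
`0` have to be of the form `a + ε a + 0`. -/
def generated (G : Type u) [CommGroup G] (ε : G) (hε : ε * ε = 1) (R : Set (Sym (WithZero G) 3))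
    (hR : ∀ a b : WithZero G, formalSum a b 0 ∈ R → b = ε * a) : Pasture.{u} where
  carrier := WithZero G
  neg a := ε * a
  null := {t | ∃ d : WithZero G, ∃ s : Sym (WithZero G) 3,
    (s = formalSum 1 (ε : WithZero G) 0 ∨ s ∈ R) ∧ t = s.map (fun a => d * a)}
  null_smul := by
    rintro _ ⟨d, s, hs, rfl⟩ e
    refine ⟨e * d, s, hs, ?_⟩
    rw [Sym.map_map]
    refine Sym.map_congr fun x _ => ?_
    simp [mul_assoc]
  null_zero_iff := by
    have hε' : (ε : WithZero G) * ε = 1 := by exact_mod_cast hε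
    have aux : ∀ a b : WithZero G, formalSum a b 0 = formalSum 1 (ε : WithZero G) 0 →
        b = ε * a := by
      intro a b h
      have h1 : a ::ₛ b ::ₛ Sym.nil = (1 : WithZero G) ::ₛ (ε : WithZero G) ::ₛ Sym.nil := by
        have h2 : (0 : WithZero G) ::ₛ a ::ₛ b ::ₛ Sym.nil
            = (0 : WithZero G) ::ₛ (1 : WithZero G) ::ₛ (ε : WithZero G) ::ₛ Sym.nil := by
          rw [Sym.cons_swap 0 a, Sym.cons_swap 0 b, Sym.cons_swap 0 1,
            Sym.cons_swap 0 (ε : WithZero G)]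
          exact h
        exact (Sym.cons_inj_right _ _ _).1 h2
      have ha : a ∈ (1 : WithZero G) ::ₛ (ε : WithZero G) ::ₛ Sym.nil := by
        rw [← h1]; exact Sym.mem_cons_self _ _
      rcases Sym.mem_cons.1 ha with rfl | ha
      · have h3 := (Sym.cons_inj_right _ _ _).1 h1
        have h4 := (Sym.cons_inj_left _ _ _).1 h3
        rw [h4, mul_one]
      · have ha : a = ε := by simpa using ha
        subst ha
        rw [Sym.cons_swap 1] at h1
        have h3 := (Sym.cons_inj_right _ _ _).1 h1
        have h4 := (Sym.cons_inj_left _ _ _).1 h3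
        rw [h4, hε']
    intro a b
    constructor
    · rintro ⟨d, s, hs, h⟩
      by_cases hd : d = 0
      · subst hd
        have hz : ∀ x ∈ formalSum a b 0, x = 0 := by
          intro x hx
          rw [h, Sym.mem_map] at hx
          obtain ⟨y, -, rfl⟩ := hx
          simp
        rw [hz a (by simp [formalSum]), hz b (by simp [formalSum]), mul_zero]
      · have hs' : s = formalSum (d⁻¹ * a) (d⁻¹ * b) 0 := by
          have h2 : (formalSum a b 0).map (fun x => d⁻¹ * x) = s := by
            rw [h, Sym.map_map]
            conv_rhs => rw [← Sym.map_id s]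
            refine Sym.map_congr fun x _ => ?_
            simp [hd]
          rw [← h2]
          simp [formalSum_map]
        have key : d⁻¹ * b = ε * (d⁻¹ * a) := by
          rcases hs with hs | hs
          · exact aux _ _ (hs' ▸ hs)
          · exact hR _ _ (hs' ▸ hs)
        have := congrArg (fun x => d * x) key
        simpa [hd, mul_left_comm] using this
    · rintro rfl
      refine ⟨a, _, Or.inl rfl, ?_⟩
      simp [formalSum_map, mul_comm]

/-- The regular partial field `𝔽₁^± = {0, 1, -1}` with null set `{0, 1 + (-1)}`. -/
def regular : Pasture.{0} :=
  generated ℤˣ (-1) (by simp) ∅ (fun _ _ h => h.elim)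

/-- The extension by zero of a homomorphism on the unit group of a pasture. -/
noncomputable def extendZero (P : Pasture.{u}) {G : Type u} [CommGroup G] (φ : Pˣ →* G) :
    P →*₀ WithZero G := by
  classical
  exact
    { toFun := fun a => WithZero.map' φ (WithZero.withZeroUnitsEquiv.symm a)
      map_zero' := by simp
      map_one' := by rw [map_one, map_one]
      map_mul' := fun a b => by rw [map_mul, map_mul] }

theorem extendZero_unit (P : Pasture.{u}) {G : Type u} [CommGroup G] (φ : Pˣ →* G) (a : Pˣ) :
    P.extendZero φ a = (φ a : WithZero G) := by
  classical
  change WithZero.map' φ (WithZero.withZeroUnitsEquiv.symm (a : P)) = _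
  rw [WithZero.withZeroUnitsEquiv_symm_apply_coe, WithZero.map'_coe]

theorem extendZero_eq_zero (P : Pasture.{u}) {G : Type u} [CommGroup G] (φ : Pˣ →* G) (a : P) :
    P.extendZero φ a = 0 ↔ a = 0 := map_eq_zero _

/-- Images of null sums that involve zero have the expected form. -/
theorem extendZero_null (P : Pasture.{u}) {G : Type u} [CommGroup G] (φ : Pˣ →* G)
    (t : Sym P 3) (ht : t ∈ P.null) (a b : WithZero G)
    (h : formalSum a b 0 = t.map (P.extendZero φ)) :
    b = (φ P.negOne : WithZero G) * a := by
  have h0 : (0 : WithZero G) ∈ t.map (P.extendZero φ) := by rw [← h]; simp [formalSum]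
  obtain ⟨z, hz, hz0⟩ := Sym.mem_map.1 h0
  obtain rfl := (P.extendZero_eq_zero φ z).1 hz0
  obtain ⟨t', rfl⟩ := Sym.exists_cons_of_mem hz
  have h1 : a ::ₛ b ::ₛ Sym.nil = t'.map (P.extendZero φ) := by
    have h2 : (0 : WithZero G) ::ₛ a ::ₛ b ::ₛ Sym.nil
        = (0 : WithZero G) ::ₛ t'.map (P.extendZero φ) := by
      rw [Sym.cons_swap 0 a, Sym.cons_swap 0 b]
      rw [Sym.map_cons, map_zero] at h
      exact h
    exact (Sym.cons_inj_right _ _ _).1 h2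
  have ha : a ∈ t'.map (P.extendZero φ) := by rw [← h1]; simp
  obtain ⟨x, hx, rfl⟩ := Sym.mem_map.1 ha
  obtain ⟨t'', rfl⟩ := Sym.exists_cons_of_mem hx
  rw [Sym.map_cons] at h1
  have h3 := (Sym.cons_inj_right _ _ _).1 h1
  have hb : b ∈ t''.map (P.extendZero φ) := by rw [← h3]; simp
  obtain ⟨y, hy, rfl⟩ := Sym.mem_map.1 hb
  obtain ⟨t3, rfl⟩ := Sym.exists_cons_of_mem hy
  obtain rfl := Sym.eq_nil_of_card_zero t3
  have h4 : formalSum x y 0 ∈ P.null := by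
    rw [Sym.cons_swap 0 x, Sym.cons_swap 0 y] at ht
    exact ht
  have h5 : y = -x := (P.null_zero_iff x y).1 h4
  rw [h5, neg_eq_mul, map_mul]
  congr 1
  exact P.extendZero_unit φ P.negOne

/-- The free algebra `P⟨x_i | i ∈ I⟩`: its unit group is the product of `Pˣ` with the free abelian
group on `I`, and its null set is generated by that of `P`. -/
noncomputable def free (P : Pasture.{0}) (I : Type) : Pasture.{0} :=
  generated (Pˣ × Multiplicative (I →₀ ℤ)) (P.negOne, 1)
    (Prod.ext (Units.ext P.neg_one_mul_neg_one) (one_mul _))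
    {s | ∃ t ∈ P.null, s = t.map (P.extendZero (MonoidHom.inl Pˣ (Multiplicative (I →₀ ℤ))))}
    (fun a b ⟨t, ht, h⟩ => P.extendZero_null _ t ht a b h)

/-- The indeterminate `x_i` of the free algebra, as a unit. -/
noncomputable def free.x (P : Pasture.{0}) {I : Type} (i : I) : (P.free I)ˣ :=
  Units.mk0 (G₀ := WithZero (Pˣ × Multiplicative (I →₀ ℤ)))
    (((1, Multiplicative.ofAdd (Finsupp.single i 1)) : Pˣ × Multiplicative (I →₀ ℤ)) :
      WithZero (Pˣ × Multiplicative (I →₀ ℤ))) WithZero.coe_ne_zero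

/-- The subgroup of `Pˣ` generated by the quotients `a / (-b)` for the relations `a + b + 0`
in `S`. -/
def relSubgroup (P : Pasture.{u}) (S : Set (Pˣ × Pˣ × P)) : Subgroup Pˣ :=
  Subgroup.closure {u | ∃ a b : Pˣ, (a, b, (0 : P)) ∈ S ∧ u = a * (P.negOne * b)⁻¹}

/-- The quotient `P ⫽ ⟨a_j + b_j + c_j | j ∈ J⟩` by a set of relations with `a_j, b_j ∈ Pˣ` and
`c_j ∈ P`: the monoid is the quotient of `P` that identifies `d a_j` with `-d b_j` whenever
`c_j = 0`, and the null set is generated by the classes of the null sums of `P` and of the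
relations. -/
noncomputable def quot (P : Pasture.{u}) (S : Set (Pˣ × Pˣ × P)) : Pasture.{u} :=
  generated (Pˣ ⧸ P.relSubgroup S) (QuotientGroup.mk' (P.relSubgroup S) P.negOne)
    (by rw [← map_mul, ← map_one (QuotientGroup.mk' (P.relSubgroup S))]
        exact congrArg _ (Units.ext P.neg_one_mul_neg_one))
    {s | (∃ t ∈ P.null, s = t.map (P.extendZero (QuotientGroup.mk' (P.relSubgroup S)))) ∨
      ∃ r ∈ S, s = (formalSum (r.1 : P) (r.2.1 : P) r.2.2).map
        (P.extendZero (QuotientGroup.mk' (P.relSubgroup S)))}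
    (by
      rintro a b (⟨t, ht, h⟩ | ⟨⟨r, s, c⟩, hr, h⟩)
      · exact P.extendZero_null _ t ht a b h
      · by_cases hc : c = 0
        · subst hc
          have hq : (QuotientGroup.mk' (P.relSubgroup S)) r
              = (QuotientGroup.mk' (P.relSubgroup S)) (P.negOne * s) := by
            refine (QuotientGroup.eq_iff_div_mem).2 ?_
            rw [div_eq_mul_inv]
            exact Subgroup.subset_closure ⟨r, s, hr, rfl⟩
          set π := QuotientGroup.mk' (P.relSubgroup S)
          have hn : formalSum ((P.negOne * s : Pˣ) : P) (s : P) 0 ∈ P.null := by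
            rw [P.null_zero_iff]
            have : ((P.negOne * s : Pˣ) : P) = -(s : P) := by
              rw [P.neg_eq_mul (s : P)]; rfl
            rw [this]
            exact (P.neg_involutive _).symm
          refine P.extendZero_null π _ hn a b ?_
          rw [h]
          simp only [formalSum, Sym.map_cons, P.extendZero_unit π, hq]
        · exfalso
          have h0 : (0 : WithZero (Pˣ ⧸ P.relSubgroup S)) ∈ formalSum a b 0 := by
            simp [formalSum]
          rw [h] at h0
          obtain ⟨z, hz, hz0⟩ := Sym.mem_map.1 h0
          have hz' := (P.extendZero_eq_zero _ z).1 hz0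
          subst hz'
          simp [formalSum, eq_comm, hc] at hz)

/-- The pasture `𝕍 = 𝔽₁^±⟨x_1, …, x_5⟩ ⫽ ⟨x_i + x_{i-1} x_{i+1} - 1 | i = 1, …, 5⟩`, with indices
modulo `5`. -/
noncomputable def V : Pasture.{0} :=
  (regular.free (ZMod 5)).quot
    {r | ∃ i : ZMod 5, r = (free.x regular i, free.x regular (i - 1) * free.x regular (i + 1), -1)}

end Pasture

/-! ### Tutte groups and the foundation of a matroid -/

namespace Matroid

variable {α : Type u} (M : Matroid α)

/-- The tuple `I` consists of distinct elements that form a basis of `M`. -/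
def IsBasisTuple {s : ℕ} (I : Fin s → α) : Prop :=
  Function.Injective I ∧ M.IsBase (Set.range I)

/-- The ordered bases of `M`. (The length of such a tuple is the rank of `M`.) -/
abbrev BasisTuple : Type u := {p : Σ s : ℕ, Fin s → α // M.IsBasisTuple p.2}

/-- The tuple `𝐉 a b`. -/
abbrev extend {s : ℕ} (J : Fin s → α) (a b : α) : Fin (s + 2) → α := Fin.append J ![a, b]

/-- The abelian group generated by `-1` and the symbols `T_I`, one for each ordered basis `I`, with
the single relation `(-1)² = 1`. -/
abbrev TutteFree : Type u := ℤˣ × Multiplicative (M.BasisTuple →₀ ℤ)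

variable {M} in
/-- The symbol `T_I`. -/
noncomputable def tutteSymbol {s : ℕ} {I : Fin s → α} (hI : M.IsBasisTuple I) : M.TutteFree :=
  (1, Multiplicative.ofAdd (Finsupp.single (⟨⟨s, I⟩, hI⟩ : M.BasisTuple) 1))

/-- The tuple `(J, a, b, c, d)` belongs to `Ω_M`: each of `Jac`, `Jad`, `Jbc`, `Jbd` is a basis. -/
structure IsOmega {s : ℕ} (J : Fin s → α) (a b c d : α) : Prop where
  ac : M.IsBasisTuple (extend J a c)
  ad : M.IsBasisTuple (extend J a d)
  bc : M.IsBasisTuple (extend J b c)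
  bd : M.IsBasisTuple (extend J b d)

/-- The tuple `(J, a, b, c, d)` in `Ω_M` is non-degenerate: also `Jab` and `Jcd` are bases. -/
structure IsOmegaOct {s : ℕ} (J : Fin s → α) (a b c d : α) : Prop
    extends M.IsOmega J a b c d where
  ab : M.IsBasisTuple (extend J a b)
  cd : M.IsBasisTuple (extend J c d)

/-- The relators of the extended Tutte group: `T_{σ(I)} = sign(σ) T_I` for all permutations `σ`,
and `T_{Jac} T_{Jbd} = T_{Jad} T_{Jbc}` for all degenerate tuples of `Ω_M`. -/
inductive TutteRelator : M.TutteFree → Prop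
  | perm {s : ℕ} (I : Fin s → α) (σ : Equiv.Perm (Fin s)) (h : M.IsBasisTuple I)
      (h' : M.IsBasisTuple (I ∘ σ)) :
      TutteRelator (tutteSymbol h' / ((Equiv.Perm.sign σ, 1) * tutteSymbol h))
  | degenerate {s : ℕ} (J : Fin s → α) (a b c d : α) (h : M.IsOmega J a b c d)
      (hdeg : ¬ M.IsOmegaOct J a b c d) :
      TutteRelator ((tutteSymbol h.ac * tutteSymbol h.bd) / (tutteSymbol h.ad * tutteSymbol h.bc))

/-- The subgroup of relations of the extended Tutte group. -/
noncomputable def tutteRelations : Subgroup M.TutteFree := Subgroup.closure {x | M.TutteRelator x}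

/-- The extended Tutte group of `M`, with generators `-1` and `T_I` for the ordered bases `I`. -/
abbrev ExtendedTutteGroup : Type u := M.TutteFree ⧸ M.tutteRelations

/-- The element `-1` of the extended Tutte group. -/
noncomputable def tutteNegOne : M.ExtendedTutteGroup := QuotientGroup.mk ((-1, 1) : M.TutteFree)

variable {M} in
/-- The element `T_I` of the extended Tutte group. -/
noncomputable def tutteT {s : ℕ} {I : Fin s → α} (hI : M.IsBasisTuple I) :
    M.ExtendedTutteGroup := QuotientGroup.mk (tutteSymbol hI)

/-- The multidegree of a word in the generators: `-1` has multidegree `0`, and `T_I` has as its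
multidegree the indicator function of the set underlying `I`. -/
noncomputable def multidegreeFree : M.TutteFree →* Multiplicative (α →₀ ℤ) :=
  (AddMonoidHom.toMultiplicative (Finsupp.liftAddHom (fun p : M.BasisTuple =>
    (zmultiplesHom (α →₀ ℤ)) (∑ k, Finsupp.single (p.1.2 k) 1)))).comp
    (MonoidHom.snd ℤˣ (Multiplicative (M.BasisTuple →₀ ℤ)))

theorem multidegreeFree_symbol {s : ℕ} {I : Fin s → α} (hI : M.IsBasisTuple I) :
    M.multidegreeFree (tutteSymbol hI)
      = Multiplicative.ofAdd (∑ k, Finsupp.single (I k) (1 : ℤ)) := by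
  simp [multidegreeFree, tutteSymbol]

theorem multidegreeFree_extend {s : ℕ} {J : Fin s → α} {a b : α}
    (h : M.IsBasisTuple (extend J a b)) :
    M.multidegreeFree (tutteSymbol h)
      = Multiplicative.ofAdd (∑ k, Finsupp.single (J k) (1 : ℤ)) *
        Multiplicative.ofAdd (Finsupp.single a (1 : ℤ)) *
        Multiplicative.ofAdd (Finsupp.single b (1 : ℤ)) := by
  rw [multidegreeFree_symbol, Fin.sum_univ_add, Fin.sum_univ_two]
  simp [extend, ofAdd_add, mul_assoc, Fin.append_right]

theorem multidegreeFree_relations : M.tutteRelations ≤ M.multidegreeFree.ker := by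
  rw [tutteRelations, Subgroup.closure_le]
  rintro x hx
  change M.multidegreeFree x = 1
  cases hx with
  | perm I σ h h' =>
    rw [map_div, map_mul, multidegreeFree_symbol, multidegreeFree_symbol]
    have h1 : M.multidegreeFree (Equiv.Perm.sign σ, 1) = 1 := by simp [multidegreeFree]
    rw [h1, one_mul, div_eq_one]
    congr 1
    exact Equiv.sum_comp σ (fun k => Finsupp.single (I k) (1 : ℤ))
  | degenerate J a b c d h hdeg =>
    rw [map_div, map_mul, map_mul, multidegreeFree_extend, multidegreeFree_extend,
      multidegreeFree_extend, multidegreeFree_extend, div_eq_one]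
    ac_rfl

/-- The multidegree on the extended Tutte group. -/
noncomputable def multidegree : M.ExtendedTutteGroup →* Multiplicative (α →₀ ℤ) :=
  QuotientGroup.lift M.tutteRelations M.multidegreeFree
    (fun _ h => M.multidegreeFree_relations h)

/-- The Tutte group of `M`: the subgroup generated by `-1` and the quotients `T_I / T_J`. -/
noncomputable def tutteGroup : Subgroup M.ExtendedTutteGroup :=
  Subgroup.closure ({M.tutteNegOne} ∪ {x | ∃ (s t : ℕ) (I : Fin s → α) (J : Fin t → α)
    (hI : M.IsBasisTuple I) (hJ : M.IsBasisTuple J), x = tutteT hI / tutteT hJ})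

/-- The inner Tutte group of `M`: the elements of multidegree zero in the Tutte group. -/
noncomputable def innerTutteGroup : Subgroup M.ExtendedTutteGroup :=
  M.tutteGroup ⊓ M.multidegree.ker

/-- The element `-1` of the inner Tutte group. -/
noncomputable def innerNegOne : M.innerTutteGroup :=
  ⟨M.tutteNegOne, Subgroup.subset_closure (Or.inl rfl), by
    change M.multidegreeFree (-1, 1) = 1
    simp [multidegreeFree]⟩

theorem innerNegOne_mul_self : M.innerNegOne * M.innerNegOne = 1 := by
  apply Subtype.ext
  change (QuotientGroup.mk (((-1, 1) : M.TutteFree) * (-1, 1)) : M.ExtendedTutteGroup)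
    = QuotientGroup.mk 1
  congr 1

variable {M} in
/-- The universal cross ratio `T_{Jac} T_{Jbd} / (T_{Jad} T_{Jbc})` in the inner Tutte group. -/
noncomputable def crossRatio {s : ℕ} {J : Fin s → α} {a b c d : α} (h : M.IsOmega J a b c d) :
    M.innerTutteGroup :=
  ⟨(tutteT h.ac * tutteT h.bd) / (tutteT h.ad * tutteT h.bc), by
    constructor
    · rw [mul_div_mul_comm]
      exact mul_mem (Subgroup.subset_closure (Or.inr ⟨_, _, _, _, h.ac, h.ad, rfl⟩))
        (Subgroup.subset_closure (Or.inr ⟨_, _, _, _, h.bd, h.bc, rfl⟩))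
    · change M.multidegreeFree
        ((tutteSymbol h.ac * tutteSymbol h.bd) / (tutteSymbol h.ad * tutteSymbol h.bc)) = 1
      rw [map_div, map_mul, map_mul, multidegreeFree_extend, multidegreeFree_extend,
        multidegreeFree_extend, multidegreeFree_extend, div_eq_one]
      ac_rfl⟩

/-- The foundation of `M`: the pasture whose unit group is the inner Tutte group and whose null set
is generated by the sums `[a b; c d]_J + [a c; b d]_J - 1` for all non-degenerate tuples. -/
noncomputable def foundation : Pasture.{u} :=
  Pasture.generated M.innerTutteGroup M.innerNegOne M.innerNegOne_mul_self
    {t | ∃ (s : ℕ) (J : Fin s → α) (a b c d : α) (h : M.IsOmegaOct J a b c d)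
      (h' : M.IsOmegaOct J a c b d),
      t = formalSum (crossRatio h.toIsOmega : WithZero M.innerTutteGroup)
        (crossRatio h'.toIsOmega : WithZero M.innerTutteGroup)
        (M.innerNegOne : WithZero M.innerTutteGroup)}
    (by
      rintro a b ⟨s, J, e, f, g, k, h, h', ht⟩
      have h0 : (0 : WithZero M.innerTutteGroup) ∈ formalSum a b 0 := by simp [formalSum]
      rw [ht] at h0
      simp [formalSum] at h0)

/-- The uniform matroid `U^r_n` with ground set `{0, …, n - 1}`: the independent sets are the sets
with at most `r` elements. -/
def uniform (r n : ℕ) : Matroid (Fin n) :=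
  (IndepMatroid.ofFinite (E := Set.univ) Set.finite_univ (fun I => I.ncard ≤ r)
    (by simp)
    (fun I J hJ hIJ => (Set.ncard_le_ncard hIJ (Set.toFinite J)).trans hJ)
    (fun I J _ hJ hlt => by
      obtain ⟨e, heJ, heI⟩ := Set.exists_mem_notMem_of_ncard_lt_ncard hlt (Set.toFinite I)
      refine ⟨e, heJ, heI, ?_⟩
      rw [Set.ncard_insert_of_notMem heI (Set.toFinite I)]
      omega)
    (fun I _ => Set.subset_univ I)).matroid

end Matroid

/-! Over `𝕍` there is a normalized `2 × 5` matrix with columns `(1, 0)` and `(-y, 1)` for `y = 0, 1,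
1/x₄, 1/(x₂x₄)`. The relations of `𝕍` make every difference of two of these `y` a monomial, so its
Plücker coordinates are monomials and give an alternating function on ordered bases. The proof shows
that evaluating `T_I` at this function identifies the foundation of `U^2_5` with `𝕍`.

Evaluation is well defined for any alternating function: in a uniform matroid a degenerate relation
has `a = b` or `c = d`, hence is trivial (`valueFree_relations`). It is surjective on the inner
Tutte group because each `x_i` is a cross ratio of the four elements other than `i`. For injectivity
(`innerValue_injective`), sorted bases and signs generate the extended Tutte group, so an element is
a sign together with an exponent vector in `ℤ¹⁰`. Five linear conditions say that the multidegree
vanishes, five that the value has trivial exponents; together they force the vector to be zero, and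
the value then determines the sign.

For the null sets, a finite check shows that each three-term relation is a multiple of a defining
relation of `𝕍`, and that each defining relation occurs. `nonempty_foundation_iso_V` collects these
conditions for arbitrary rank. For `U^3_5` they are verified for the dual coordinates: those of
complementary pairs, with the sign of the complementation. -/

theorem formalSum_congr {A : Type u} {a b c a' b' c' : A} (ha : a = a') (hb : b = b') (hc : c = c') :
    formalSum a b c = formalSum a' b' c' := by
  rw [ha, hb, hc]

namespace Pasture

/-! ### Morphisms between pastures given by generators of the null set -/

section Generated

variable {G G' : Type u} [CommGroup G] [CommGroup G'] {ε : G} {ε' : G'} {hε : ε * ε = 1}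
  {hε' : ε' * ε' = 1} {R : Set (Sym (WithZero G) 3)} {R' : Set (Sym (WithZero G') 3)}
  {hR : ∀ a b : WithZero G, formalSum a b 0 ∈ R → b = ε * a}
  {hR' : ∀ a b : WithZero G', formalSum a b 0 ∈ R' → b = ε' * a}

theorem mem_null_of_mem {t : Sym (WithZero G) 3} (ht : t ∈ R) :
    t ∈ (generated G ε hε R hR).null := by
  refine ⟨1, t, Or.inr ht, ?_⟩
  conv_lhs => rw [← Sym.map_id t]
  exact Sym.map_congr fun x _ => (one_mul x).symm

/-- A multiplicative map out of a generated pasture that sends `-1` to `-1` and the generators of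
the null set to null sums preserves null sums. -/
theorem map_mem_null {Q : Pasture.{u}} (ψ : WithZero G →*₀ Q) (hψ : ψ ε = -1)
    (h : ∀ t ∈ R, t.map ψ ∈ Q.null) :
    ∀ t ∈ (generated G ε hε R hR).null, t.map ψ ∈ Q.null := by
  rintro _ ⟨d, s, hs, rfl⟩
  have key : s.map ψ ∈ Q.null := by
    rcases hs with rfl | hs
    · rw [formalSum_map, map_one, map_zero, hψ]
      exact (Q.null_zero_iff 1 (-1)).2 rfl
    · exact h s hs
  have h2 := Q.null_smul _ key (ψ d)
  have h3 : (s.map (fun a => d * a)).map ψ = (s.map ψ).map (fun a => ψ d * a) := by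
    rw [Sym.map_map, Sym.map_map]
    exact Sym.map_congr fun x _ => map_mul ψ d x
  exact h3 ▸ h2

theorem generated_neg_one : (-1 : generated G ε hε R hR) = (ε : WithZero G) := mul_one _

/-- A homomorphism of unit groups that sends `-1` to `-1` and the generators of the null set to null
sums is a morphism of pastures. -/
def homOfMonoidHom (φ : G →* G') (hφ : φ ε = ε')
    (h : ∀ t ∈ R, t.map (WithZero.map' φ) ∈ (generated G' ε' hε' R' hR').null) :
    generated G ε hε R hR ⟶ generated G' ε' hε' R' hR' where
  toHom := WithZero.map' φ
  map_null := map_mem_null (Q := generated G' ε' hε' R' hR') (WithZero.map' φ)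
    (by
      refine (WithZero.map'_coe φ ε).trans ?_
      rw [hφ, generated_neg_one]) h

/-- An isomorphism of unit groups that preserves `-1` and identifies the null sets is an isomorphism
of pastures. -/
theorem nonempty_iso_of_mulEquiv (e : G ≃* G') (he : e ε = ε')
    (h : ∀ t ∈ R, t.map (WithZero.map' e.toMonoidHom) ∈ (generated G' ε' hε' R' hR').null)
    (h' : ∀ t ∈ R', t.map (WithZero.map' e.symm.toMonoidHom) ∈ (generated G ε hε R hR).null) :
    Nonempty (generated G ε hε R hR ≅ generated G' ε' hε' R' hR') := by
  refine ⟨⟨homOfMonoidHom e.toMonoidHom he h,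
    homOfMonoidHom e.symm.toMonoidHom (by simp [← he]) h', ?_, ?_⟩⟩
  · refine Hom.ext ?_
    change (WithZero.map' e.symm.toMonoidHom).comp (WithZero.map' e.toMonoidHom)
      = MonoidWithZeroHom.id (WithZero G)
    rw [← WithZero.map'_comp]
    ext x
    simp
  · refine Hom.ext ?_
    change (WithZero.map' e.toMonoidHom).comp (WithZero.map' e.symm.toMonoidHom)
      = MonoidWithZeroHom.id (WithZero G')
    rw [← WithZero.map'_comp]
    ext x
    simp

end Generated

/-! ### An explicit model of `𝕍` -/

/-- The group `{±1} × ℤ⁵`, with the exponents of monomials as functions. -/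
abbrev SignedMonomial : Type := ℤˣ × Multiplicative (ZMod 5 → ℤ)

namespace SignedMonomial

/-- The monomial `x_i`. -/
def x (i : ZMod 5) : SignedMonomial := (1, Multiplicative.ofAdd (Pi.single i 1))

/-- The element `-1`. -/
def minusOne : SignedMonomial := (-1, 1)

end SignedMonomial

open SignedMonomial in
/-- A model of `𝕍` whose unit group is a group of explicit signed monomials. -/
def explicitV : Pasture.{0} :=
  generated SignedMonomial minusOne (by decide)
    {t | ∃ i : ZMod 5, t = formalSum (x i : WithZero SignedMonomial)
      ((x (i - 1) * x (i + 1) : SignedMonomial) : WithZero SignedMonomial)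
      (minusOne : WithZero SignedMonomial)}
    (by
      rintro a b ⟨i, h⟩
      have h0 : (0 : WithZero SignedMonomial) ∈ formalSum a b 0 := by simp [formalSum]
      rw [h] at h0
      simp [formalSum] at h0)

/-- The units of a generated pasture. -/
def unitsGenerated {G : Type u} [CommGroup G] (ε : G) (hε : ε * ε = 1)
    (R : Set (Sym (WithZero G) 3)) (hR) : (generated G ε hε R hR)ˣ ≃* G :=
  WithZero.unitsWithZeroEquiv (α := G)

/-- The set of relations that defines `𝕍`. -/
def relationsV : Set ((regular.free (ZMod 5))ˣ × (regular.free (ZMod 5))ˣ × regular.free (ZMod 5)) :=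
  {r | ∃ i : ZMod 5, r = (free.x regular i, free.x regular (i - 1) * free.x regular (i + 1), -1)}

/-- Units are identified only by relations whose third term is `0`, whereas here it is always `-1`.
Hence the unit group of `𝕍` is that of the free algebra. -/
theorem relSubgroup_relationsV : (regular.free (ZMod 5)).relSubgroup relationsV = ⊥ := by
  rw [relSubgroup, Subgroup.closure_eq_bot_iff]
  rintro _ ⟨a, b, ⟨i, hi⟩, -⟩
  have h0 : (0 : regular.free (ZMod 5)) = -1 := congrArg (fun r => r.2.2) hi
  have h1 := (regular.free (ZMod 5)).neg_one_mul_neg_one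
  rw [← h0, zero_mul] at h1
  exact absurd h1 zero_ne_one

/-- The unit group of `𝕍`. -/
noncomputable def unitsV :
    (regular.free (ZMod 5))ˣ ⧸ (regular.free (ZMod 5)).relSubgroup relationsV ≃* SignedMonomial :=
  (QuotientGroup.quotientMulEquivOfEq relSubgroup_relationsV).trans <|
    QuotientGroup.quotientBot.trans <| (unitsGenerated _ _ _ _).trans <|
      MulEquiv.prodCongr (unitsGenerated _ _ _ _) <| AddEquiv.toMultiplicative <|
        (Finsupp.linearEquivFunOnFinite ℤ ℤ (ZMod 5)).toAddEquiv

theorem unitsV_x (i : ZMod 5) :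
    unitsV (QuotientGroup.mk (free.x regular i)) = SignedMonomial.x i := by
  refine Prod.ext rfl ?_
  change Multiplicative.ofAdd (⇑(Finsupp.single i (1 : ℤ))) = Multiplicative.ofAdd (Pi.single i 1)
  rw [Finsupp.single_eq_pi_single]

theorem unitsV_negOne :
    unitsV (QuotientGroup.mk (regular.free (ZMod 5)).negOne) = SignedMonomial.minusOne := by
  rfl

/-- Replacing the iterated construction by signed monomials with functions as exponents makes
identities between units decidable by evaluation, on which the finite checks for Plücker coordinates
depend. -/
theorem nonempty_V_iso_explicitV : Nonempty (V ≅ explicitV) := by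
  let π := QuotientGroup.mk' ((regular.free (ZMod 5)).relSubgroup relationsV)
  let ψ : regular.free (ZMod 5) →*₀ explicitV :=
    (WithZero.map' unitsV.toMonoidHom).comp ((regular.free (ZMod 5)).extendZero π)
  have hψ (u : (regular.free (ZMod 5))ˣ) :
      ψ u = (unitsV (QuotientGroup.mk u) : WithZero SignedMonomial) := by
    change WithZero.map' unitsV.toMonoidHom ((regular.free (ZMod 5)).extendZero π u) = _
    rw [extendZero_unit, WithZero.map'_coe]
    rfl
  have hψ1 : ψ (-1) = -1 := by
    refine (hψ (regular.free (ZMod 5)).negOne).trans ?_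
    rw [unitsV_negOne]
    exact generated_neg_one.symm
  unfold V quot explicitV
  refine nonempty_iso_of_mulEquiv unitsV unitsV_negOne ?_ ?_
  · rintro _ (⟨t, ht, rfl⟩ | ⟨_, ⟨i, rfl⟩, rfl⟩)
    · rw [Sym.map_map]
      -- The null set of the free algebra is generated by that of `𝔽₁^±`, which in turn has no
      -- generators besides `1 + (-1)`. Both layers thus reduce to `ψ (-1) = -1`.
      refine map_mem_null (Q := explicitV) ψ (by rw [← hψ1]; exact congrArg ψ generated_neg_one.symm)
        ?_ t ht
      rintro _ ⟨s, hs, rfl⟩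
      rw [Sym.map_map]
      refine map_mem_null (Q := explicitV)
        (ψ.comp (regular.extendZero (MonoidHom.inl regularˣ (Multiplicative (ZMod 5 →₀ ℤ)))))
        ?_ (fun _ h => h.elim) s hs
      rw [← hψ1]
      refine congrArg ψ ?_
      refine (congrArg _ generated_neg_one.symm).trans
        ((extendZero_unit _ _ regular.negOne).trans ?_)
      exact generated_neg_one.symm
    · refine mem_null_of_mem ⟨i, ?_⟩
      rw [Sym.map_map]
      refine (formalSum_map ψ _ _ _).trans ?_
      refine formalSum_congr ((hψ _).trans ?_) ((hψ _).trans ?_) (hψ1.trans generated_neg_one)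
      · rw [unitsV_x]
      · rw [QuotientGroup.mk_mul, map_mul, unitsV_x, unitsV_x]
  · rintro _ ⟨i, rfl⟩
    refine mem_null_of_mem (Or.inr ⟨_, ⟨i, rfl⟩, ?_⟩)
    have h1 (u : (regular.free (ZMod 5))ˣ) (g : SignedMonomial) (h : unitsV (QuotientGroup.mk u) = g) :
        WithZero.map' unitsV.symm.toMonoidHom (g : WithZero SignedMonomial)
          = (regular.free (ZMod 5)).extendZero π u := by
      rw [extendZero_unit, WithZero.map'_coe, ← h]
      exact congrArg _ (unitsV.symm_apply_apply _)
    refine formalSum_congr (h1 _ _ (unitsV_x i)) (h1 _ _ ?_) (h1 _ _ unitsV_negOne)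
    rw [QuotientGroup.mk_mul, map_mul, unitsV_x, unitsV_x]

end Pasture

/-! ### Bases and degenerate tuples of uniform matroids -/

namespace Matroid

theorem isBase_uniform_iff {r n : ℕ} (h : r ≤ n) (B : Set (Fin n)) :
    (uniform r n).IsBase B ↔ B.ncard = r := by
  have hind (I : Set (Fin n)) : (uniform r n).Indep I ↔ I.ncard ≤ r := Iff.rfl
  rw [isBase_iff_maximal_indep]
  constructor
  · intro hB
    refine le_antisymm ((hind B).1 hB.prop) (not_lt.1 fun hlt => ?_)
    obtain ⟨e, -, he⟩ : ∃ e ∈ Set.univ, e ∉ B := by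
      refine Set.exists_mem_notMem_of_ncard_lt_ncard ?_ (Set.toFinite B)
      rw [Set.ncard_univ, Nat.card_fin]
      omega
    have h2 : (uniform r n).Indep (insert e B) := by
      rw [hind, Set.ncard_insert_of_notMem he (Set.toFinite B)]
      omega
    exact he (hB.le_of_ge h2 (Set.subset_insert e B) (Set.mem_insert e B))
  · intro hB
    refine ⟨(hind B).2 hB.le, fun I hI hBI => ?_⟩
    exact (Set.eq_of_subset_of_ncard_le hBI (((hind I).1 hI).trans hB.ge) (Set.toFinite I)).ge

theorem isBasisTuple_uniform_iff {r n s : ℕ} (h : r ≤ n) (I : Fin s → Fin n) :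
    (uniform r n).IsBasisTuple I ↔ Function.Injective I ∧ s = r := by
  refine and_congr_right fun hI => ?_
  rw [isBase_uniform_iff h, ← Set.image_univ, Set.ncard_image_of_injective _ hI, Set.ncard_univ,
    Nat.card_fin]

theorem extend_injective_iff {α : Type u} {s : ℕ} {J : Fin s → α} {a b : α} :
    Function.Injective (extend J a b) ↔
      Function.Injective J ∧ (∀ k, J k ≠ a) ∧ (∀ k, J k ≠ b) ∧ a ≠ b := by
  rw [extend, Fin.append_injective_iff]
  have h : Function.Injective ![a, b] ↔ a ≠ b := by
    constructor
    · exact fun h hab => absurd (@h 0 1 hab) (by decide)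
    · intro h i j hij
      fin_cases i <;> fin_cases j <;> simp_all
  rw [h]
  simp only [Fin.forall_fin_two, Matrix.cons_val_zero, Matrix.cons_val_one, forall_and]
  tauto

/-- All `r`-subsets are bases, so `Jab` or `Jcd` can only fail to be one through a repeated entry;
the four bases of `IsOmega` exclude every repetition except these two. -/
theorem eq_or_eq_of_not_isOmegaOct {r n s : ℕ} (hr : r ≤ n) {J : Fin s → Fin n} {a b c d : Fin n}
    (h : (uniform r n).IsOmega J a b c d) (h' : ¬ (uniform r n).IsOmegaOct J a b c d) :
    a = b ∨ c = d := by
  by_contra! hne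
  have hs := ((isBasisTuple_uniform_iff hr _).1 h.ac).2
  have hac := extend_injective_iff.1 h.ac.1
  have hbd := extend_injective_iff.1 h.bd.1
  refine h' ⟨h, ?_, ?_⟩ <;> rw [isBasisTuple_uniform_iff hr, extend_injective_iff]
  · exact ⟨⟨hac.1, hac.2.1, hbd.2.1, hne.1⟩, hs⟩
  · exact ⟨⟨hac.1, hac.2.2.1, hbd.2.2.1, hne.2⟩, hs⟩

/-! ### Evaluating the Tutte group at an alternating function -/

/-- The sign of a tuple: the parity of its number of inversions. -/
def tupleSign {s n : ℕ} (I : Fin s → Fin n) : ℤˣ :=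
  ∏ i, ∏ j ∈ Finset.Ioi i, if I i < I j then 1 else -1

/-- The sign is a product over `i < j` of the antisymmetric expression `sign (I j - I i)`, and
permuting the indices changes such a product by the sign of the permutation. -/
theorem tupleSign_comp {s n : ℕ} {I : Fin s → Fin n} (hI : Function.Injective I)
    (σ : Equiv.Perm (Fin s)) : tupleSign (I ∘ σ) = Equiv.Perm.sign σ * tupleSign I := by
  let f (i j : Fin s) : ℤ := (((I j : ℕ) : ℤ) - ((I i : ℕ) : ℤ)).sign
  have hf (τ : Equiv.Perm (Fin s)) :
      (tupleSign (I ∘ τ) : ℤ) = ∏ i, ∏ j ∈ Finset.Ioi i, f (τ i) (τ j) := by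
    simp only [tupleSign, Units.coe_prod]
    refine Finset.prod_congr rfl fun i _ => Finset.prod_congr rfl fun j hj => ?_
    have hne : I (τ i) ≠ I (τ j) := fun h => (Finset.mem_Ioi.1 hj).ne (τ.injective (hI h))
    simp only [Function.comp_apply, f]
    split_ifs with hlt
    · rw [Int.sign_eq_one_of_pos (by rw [Fin.lt_def] at hlt; omega)]
      rfl
    · rw [Int.sign_eq_neg_one_of_neg (by rw [Fin.lt_def] at hlt; rw [Ne, Fin.ext_iff] at hne; omega)]
      rfl
  refine Units.ext ?_
  rw [hf, Equiv.Perm.prod_Ioi_comp_eq_sign_mul_prod σ (f := f), Units.val_mul]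
  · exact congrArg _ (hf 1).symm
  · intro i j
    rw [← Int.sign_neg, neg_sub]

open Pasture (SignedMonomial)

section Coordinates

variable (M : Matroid (Fin 5)) (p : Finset (Fin 5) → SignedMonomial)

/-- The alternating extension to tuples of a function on subsets. -/
def tupleValue {s : ℕ} (I : Fin s → Fin 5) : SignedMonomial :=
  (tupleSign I, 1) * p (Finset.univ.image I)

/-- The homomorphism that maps `T_I` to the value of the alternating function at `I`. -/
noncomputable def valueFree : M.TutteFree →* SignedMonomial :=
  (MonoidHom.inl ℤˣ (Multiplicative (ZMod 5 → ℤ))).comp (MonoidHom.fst _ _) *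
    (AddMonoidHom.toMultiplicativeLeft (Finsupp.liftAddHom (fun q : M.BasisTuple =>
      zmultiplesHom (Additive SignedMonomial) (Additive.ofMul (tupleValue p q.1.2))))).comp
        (MonoidHom.snd ℤˣ (Multiplicative (M.BasisTuple →₀ ℤ)))

theorem valueFree_symbol {s : ℕ} {I : Fin s → Fin 5} (hI : M.IsBasisTuple I) :
    valueFree M p (tutteSymbol hI) = tupleValue p I := by
  simp [valueFree, tutteSymbol]

theorem valueFree_sign (ε : ℤˣ) : valueFree M p (ε, 1) = (ε, 1) := by
  simp [valueFree]

end Coordinates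

theorem tupleValue_comp (p : Finset (Fin 5) → SignedMonomial) {s : ℕ} {I : Fin s → Fin 5}
    (hI : Function.Injective I) (σ : Equiv.Perm (Fin s)) :
    tupleValue p (I ∘ σ) = (Equiv.Perm.sign σ, 1) * tupleValue p I := by
  have h : Finset.univ.image (I ∘ σ) = Finset.univ.image I := by
    rw [← Finset.image_image, Finset.image_univ_equiv]
  rw [tupleValue, tupleValue, tupleSign_comp hI, h, ← mul_assoc]
  rfl

/-- No Plücker relation is required of `p`: permutation relations hold because the extension is
alternating, and in degenerate ones the two sides coincide once `a = b` or `c = d`. -/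
theorem valueFree_relations {r : ℕ} (hr : r ≤ 5) (p : Finset (Fin 5) → SignedMonomial) :
    (uniform r 5).tutteRelations ≤ (valueFree (uniform r 5) p).ker := by
  rw [tutteRelations, Subgroup.closure_le]
  rintro x hx
  change valueFree _ p x = 1
  cases hx with
  | perm I σ h h' =>
    rw [map_div, map_mul, valueFree_symbol, valueFree_symbol, valueFree_sign,
      tupleValue_comp p h.1, div_self']
  | degenerate J a b c d h hdeg =>
    rcases eq_or_eq_of_not_isOmegaOct hr h hdeg with rfl | rfl
    · rw [mul_comm, div_self', map_one]
    · rw [div_self', map_one]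

/-- The homomorphism on the extended Tutte group that maps `T_I` to the value of the alternating
function at `I`. -/
noncomputable def value {r : ℕ} (hr : r ≤ 5) (p : Finset (Fin 5) → SignedMonomial) :
    (uniform r 5).ExtendedTutteGroup →* SignedMonomial :=
  QuotientGroup.lift _ (valueFree (uniform r 5) p) fun _ h => valueFree_relations hr p h

theorem value_crossRatio {r : ℕ} (hr : r ≤ 5) (p : Finset (Fin 5) → SignedMonomial) {s : ℕ}
    {J : Fin s → Fin 5} {a b c d : Fin 5} (h : (uniform r 5).IsOmega J a b c d) :
    value hr p (crossRatio h) = tupleValue p (extend J a c) * tupleValue p (extend J b d) /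
      (tupleValue p (extend J a d) * tupleValue p (extend J b c)) := by
  change valueFree _ p
    ((tutteSymbol h.ac * tutteSymbol h.bd) / (tutteSymbol h.ad * tutteSymbol h.bc)) = _
  rw [map_div, map_mul, map_mul, valueFree_symbol, valueFree_symbol, valueFree_symbol,
    valueFree_symbol]

/-! ### Injectivity as a linear algebra problem -/

/-- The homomorphism from signed monomials in the symbols of given ordered bases to the free
group on all ordered bases. -/
noncomputable def ofSorted {M : Matroid (Fin 5)} {ι : Type} (B : ι → M.BasisTuple) :
    ℤˣ × Multiplicative (ι →₀ ℤ) →* M.TutteFree :=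
  MonoidHom.prodMap (MonoidHom.id ℤˣ)
    (AddMonoidHom.toMultiplicative (Finsupp.mapDomain.addMonoidHom B))

theorem exists_ofSorted {r : ℕ} (hr : r ≤ 5) {ι : Type} (B : ι → (uniform r 5).BasisTuple)
    (hB : ∀ I : Fin r → Fin 5, StrictMono I → ∃ k, (B k).1 = ⟨r, I⟩)
    (w : (uniform r 5).ExtendedTutteGroup) : ∃ y, QuotientGroup.mk (ofSorted B y) = w := by
  let H : Subgroup (uniform r 5).ExtendedTutteGroup :=
    ((QuotientGroup.mk' (uniform r 5).tutteRelations).comp (ofSorted B)).range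
  have hsign (ε : ℤˣ) : (QuotientGroup.mk (ε, 1) : (uniform r 5).ExtendedTutteGroup) ∈ H := by
    refine ⟨(ε, 1), ?_⟩
    change QuotientGroup.mk (ofSorted B (ε, 1)) = _
    simp [ofSorted]
  have hT (q : (uniform r 5).BasisTuple) : tutteT q.2 ∈ H := by
    obtain ⟨⟨s, I⟩, hI⟩ := q
    obtain ⟨hinj, rfl⟩ := (isBasisTuple_uniform_iff hr I).1 hI
    -- The increasing rearrangement of `I` is one of the given tuples, and the permutation relation
    -- recovers `T_I` from it up to sign.
    let σ := Tuple.sort I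
    have hI' : (uniform s 5).IsBasisTuple (I ∘ σ) :=
      (isBasisTuple_uniform_iff hr _).2 ⟨hinj.comp σ.injective, rfl⟩
    have hmem : tutteT hI' ∈ H := by
      obtain ⟨k, hk⟩ := hB (I ∘ σ) ((Tuple.monotone_sort I).strictMono_of_injective hI'.1)
      have hk' : B k = ⟨⟨s, I ∘ σ⟩, hI'⟩ := Subtype.ext hk
      refine ⟨(1, Multiplicative.ofAdd (Finsupp.single k 1)), ?_⟩
      change QuotientGroup.mk (ofSorted B _) = _
      simp [ofSorted, tutteT, tutteSymbol, hk', Finsupp.mapDomain_single]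
    have hrel : tutteT hI' / (QuotientGroup.mk (Equiv.Perm.sign σ, 1) * tutteT hI) = 1 :=
      (QuotientGroup.eq_one_iff _).2 (Subgroup.subset_closure (TutteRelator.perm I σ hI hI'))
    rw [div_eq_one] at hrel
    rw [hrel] at hmem
    exact (Subgroup.mul_mem_cancel_left H (hsign _)).1 hmem
  obtain ⟨⟨ε, f⟩, rfl⟩ := QuotientGroup.mk_surjective w
  change _ ∈ H
  have h1 : ((ε, f) : (uniform r 5).TutteFree) = (ε, 1) * (1, f) := by simp
  rw [h1, QuotientGroup.mk_mul]
  refine mul_mem (hsign ε) ?_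
  clear h1
  induction f using Multiplicative.rec with | _ f
  induction f using Finsupp.induction_linear with
  | zero => exact one_mem H
  | add f g hf hg => exact mul_mem hf hg
  | single q m =>
    have h2 : ((1, Multiplicative.ofAdd (Finsupp.single q m)) : (uniform r 5).TutteFree)
        = tutteSymbol q.2 ^ m := by
      refine Prod.ext (by simp [tutteSymbol]) ?_
      simp [tutteSymbol, ← ofAdd_zsmul]
    rw [h2, QuotientGroup.mk_zpow]
    exact zpow_mem (hT q) m

/-- Signs of tuples affect only the first component, so the exponents of a value depend linearly on
`v`. -/
theorem valueFree_ofSorted_snd {M : Matroid (Fin 5)} (p : Finset (Fin 5) → SignedMonomial)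
    {ι : Type} [Fintype ι] (B : ι → M.BasisTuple) (ε : ℤˣ) (v : ι →₀ ℤ) (i : ZMod 5) :
    (valueFree M p (ofSorted B (ε, Multiplicative.ofAdd v))).2.toAdd i
      = ∑ k, v k * (p (Finset.univ.image (B k).1.2)).2.toAdd i := by
  have h1 : (ε, Multiplicative.ofAdd v) = (ε, 1) * (1, Multiplicative.ofAdd v) := by simp
  have h2 : ofSorted B (ε, 1) = (ε, 1) := by simp [ofSorted]
  rw [h1, map_mul, map_mul, h2, valueFree_sign, Prod.snd_mul, one_mul]
  clear h1 h2
  induction v using Finsupp.induction_linear with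
  | zero => simp [ofSorted, valueFree]
  | add f g hf hg =>
    have h : ((1, Multiplicative.ofAdd (f + g)) : ℤˣ × Multiplicative (ι →₀ ℤ))
        = (1, Multiplicative.ofAdd f) * (1, Multiplicative.ofAdd g) := by simp
    rw [h, map_mul, map_mul, Prod.snd_mul, toAdd_mul, Pi.add_apply, hf, hg,
      ← Finset.sum_add_distrib]
    simp only [Finsupp.add_apply, add_mul]
  | single q m =>
    have h : ofSorted B (1, Multiplicative.ofAdd (Finsupp.single q m))
        = tutteSymbol (B q).2 ^ m := by
      refine Prod.ext (by simp [ofSorted, tutteSymbol]) ?_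
      simp [ofSorted, tutteSymbol, ← ofAdd_zsmul]
    rw [h, map_zpow, valueFree_symbol]
    classical
    simp [tupleValue, Finsupp.single_apply]

theorem multidegreeFree_ofSorted {M : Matroid (Fin 5)} {ι : Type} [Fintype ι] (B : ι → M.BasisTuple)
    (ε : ℤˣ) (v : ι →₀ ℤ) (j : Fin 5) :
    (M.multidegreeFree (ofSorted B (ε, Multiplicative.ofAdd v))).toAdd j
      = ∑ k, v k * ∑ l, if (B k).1.2 l = j then 1 else 0 := by
  simp [ofSorted, multidegreeFree, Finsupp.sum_fintype, Finsupp.single_apply]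

/-- The value homomorphism on the inner Tutte group. -/
noncomputable def innerValue {r : ℕ} (hr : r ≤ 5) (p : Finset (Fin 5) → SignedMonomial) :
    (uniform r 5).innerTutteGroup →* SignedMonomial :=
  (value hr p).comp (uniform r 5).innerTutteGroup.subtype

theorem innerValue_negOne {r : ℕ} (hr : r ≤ 5) (p : Finset (Fin 5) → SignedMonomial) :
    innerValue hr p (uniform r 5).innerNegOne = SignedMonomial.minusOne :=
  valueFree_sign _ p (-1)

theorem innerValue_injective {r : ℕ} (hr : r ≤ 5) (p : Finset (Fin 5) → SignedMonomial)
    {ι : Type} [Fintype ι] (B : ι → Fin r → Fin 5) (hBinj : ∀ k, Function.Injective (B k))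
    (hB : ∀ I : Fin r → Fin 5, StrictMono I → ∃ k, B k = I)
    (hlin : ∀ v : ι → ℤ, (∀ i, ∑ k, v k * (p (Finset.univ.image (B k))).2.toAdd i = 0) →
      (∀ j, ∑ k, v k * (∑ l, if B k l = j then 1 else 0) = 0) → ∀ k, v k = 0) :
    Function.Injective (innerValue hr p) := by
  rw [injective_iff_map_eq_one]
  rintro ⟨w, hw⟩ h
  let B' (k : ι) : (uniform r 5).BasisTuple :=
    ⟨⟨r, B k⟩, (isBasisTuple_uniform_iff hr _).2 ⟨hBinj k, rfl⟩⟩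
  obtain ⟨⟨ε, v⟩, rfl⟩ := exists_ofSorted hr B'
    (fun I hI => (hB I hI).imp fun k hk => by simp only [B', hk]) w
  have hval : valueFree _ p (ofSorted B' (ε, v)) = 1 := h
  have hdeg : (uniform r 5).multidegreeFree (ofSorted B' (ε, v)) = 1 := hw.2
  induction v using Multiplicative.rec with | _ v
  -- Trivial value and trivial multidegree are exactly the two families of equations in `hlin`.
  -- Afterwards only the sign `ε` is left, which the value shows to be `1`.
  have hv : v = 0 := by
    ext k
    refine hlin v (fun i => ?_) (fun j => ?_) k
    · rw [← valueFree_ofSorted_snd p B' ε v i, hval]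
      rfl
    · rw [← multidegreeFree_ofSorted B' ε v j, hdeg]
      rfl
  subst hv
  have h1 : ofSorted B' (ε, Multiplicative.ofAdd 0) = (ε, 1) := by simp [ofSorted]
  rw [h1, valueFree_sign] at hval
  have hε : ε = 1 := congrArg Prod.fst hval
  subst hε
  refine Subtype.ext ?_
  change QuotientGroup.mk (ofSorted B' 1) = _
  rw [map_one]
  rfl

theorem _root_.Pasture.SignedMonomial.eq_top_of_mem (H : Subgroup SignedMonomial)
    (h : SignedMonomial.minusOne ∈ H) (hx : ∀ i, SignedMonomial.x i ∈ H) : H = ⊤ := by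
  rw [eq_top_iff]
  rintro ⟨ε, m⟩ -
  have h1 : ((ε, m) : SignedMonomial) = (ε, 1) * ∏ i, SignedMonomial.x i ^ (m.toAdd i) := by
    refine Prod.ext ?_ ?_
    · simp [Prod.fst_prod, SignedMonomial.x]
    · refine Multiplicative.toAdd.injective (funext fun j => ?_)
      simp [Prod.snd_prod, SignedMonomial.x, Finset.sum_apply, Pi.single_apply]
  rw [h1]
  refine mul_mem ?_ (prod_mem fun i _ => zpow_mem (hx i) _)
  rcases Int.units_eq_one_or ε with rfl | rfl
  · exact one_mem H
  · exact h

/-- A function on the subsets of `Fin 5` whose alternating extension maps the three-term relations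
for `uniform r 5` to the relations of `𝕍` identifies the foundation with `𝕍`, provided that it
separates the inner Tutte group. -/
theorem nonempty_foundation_iso_V {r : ℕ} (hr : r ≤ 5) (p : Finset (Fin 5) → SignedMonomial)
    (hinj : Function.Injective (innerValue hr p))
    (hnull : ∀ {s : ℕ} (J : Fin s → Fin 5) (a b c d : Fin 5),
      (uniform r 5).IsOmegaOct J a b c d → ∃ (i : ZMod 5) (u : SignedMonomial),
        formalSum
          (tupleValue p (extend J a c) * tupleValue p (extend J b d) /
            (tupleValue p (extend J a d) * tupleValue p (extend J b c)))
          (tupleValue p (extend J a b) * tupleValue p (extend J c d) /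
            (tupleValue p (extend J a d) * tupleValue p (extend J c b)))
          SignedMonomial.minusOne =
        (formalSum (SignedMonomial.x i) (SignedMonomial.x (i - 1) * SignedMonomial.x (i + 1))
          SignedMonomial.minusOne).map (fun g => u * g))
    (hx : ∀ i : ZMod 5, ∃ (s : ℕ) (J : Fin s → Fin 5) (a b c d : Fin 5),
      (uniform r 5).IsOmegaOct J a b c d ∧ (uniform r 5).IsOmegaOct J a c b d ∧
        tupleValue p (extend J a c) * tupleValue p (extend J b d) /
          (tupleValue p (extend J a d) * tupleValue p (extend J b c)) = SignedMonomial.x i ∧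
        tupleValue p (extend J a b) * tupleValue p (extend J c d) /
          (tupleValue p (extend J a d) * tupleValue p (extend J c b))
            = SignedMonomial.x (i - 1) * SignedMonomial.x (i + 1)) :
    Nonempty ((uniform r 5).foundation ≅ Pasture.V) := by
  have hcr {s : ℕ} {J : Fin s → Fin 5} {a b c d : Fin 5} (h : (uniform r 5).IsOmega J a b c d) :
      innerValue hr p (crossRatio h)
        = tupleValue p (extend J a c) * tupleValue p (extend J b d) /
          (tupleValue p (extend J a d) * tupleValue p (extend J b c)) := value_crossRatio hr p h
  -- The target is generated by `-1` and the `x_i`, and each `x_i` is a cross ratio by `hx`.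
  have hsurj : Function.Surjective (innerValue hr p) := by
    rw [← MonoidHom.range_eq_top]
    refine SignedMonomial.eq_top_of_mem _ ⟨_, innerValue_negOne hr p⟩ fun i => ?_
    obtain ⟨s, J, a, b, c, d, h, -, h1, -⟩ := hx i
    exact ⟨crossRatio h.toIsOmega, (hcr _).trans h1⟩
  let e : (uniform r 5).innerTutteGroup ≃* SignedMonomial :=
    MulEquiv.ofBijective (innerValue hr p) ⟨hinj, hsurj⟩
  suffices Nonempty ((uniform r 5).foundation ≅ Pasture.explicitV) by
    obtain ⟨f⟩ := this
    obtain ⟨g⟩ := Pasture.nonempty_V_iso_explicitV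
    exact ⟨f.trans g.symm⟩
  unfold foundation Pasture.explicitV
  refine Pasture.nonempty_iso_of_mulEquiv e (innerValue_negOne hr p) ?_ ?_
  · rintro _ ⟨s, J, a, b, c, d, h, h', rfl⟩
    obtain ⟨i, u, hu⟩ := hnull J a b c d h
    -- The factor `u` becomes the multiplier in the generated null set. The identity in the unit
    -- group is carried over to the group with zero, with the coordinates rewritten as images of
    -- cross ratios.
    refine ⟨(u : WithZero SignedMonomial), _, Or.inr ⟨i, rfl⟩, ?_⟩
    have h2 := congrArg (Sym.map (fun g : SignedMonomial => (g : WithZero SignedMonomial))) hu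
    rw [← hcr h.toIsOmega, ← hcr h'.toIsOmega, ← innerValue_negOne hr p] at h2
    exact h2
  · rintro _ ⟨i, rfl⟩
    -- Each relation of `𝕍` is matched exactly, not just up to a unit, so it pulls back to a
    -- generator of the null set.
    obtain ⟨s, J, a, b, c, d, h, h', h1, h2⟩ := hx i
    refine Pasture.mem_null_of_mem ⟨s, J, a, b, c, d, h, h', ?_⟩
    have he (g : (uniform r 5).innerTutteGroup) (m : SignedMonomial) (hg : innerValue hr p g = m) :
        WithZero.map' e.symm.toMonoidHom (m : WithZero SignedMonomial)
          = (g : WithZero (uniform r 5).innerTutteGroup) := by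
      rw [WithZero.map'_coe, ← hg]
      exact congrArg _ (e.symm_apply_apply g)
    exact formalSum_congr (he _ _ ((hcr _).trans h1)) (he _ _ ((hcr _).trans h2))
      (he _ _ (innerValue_negOne hr p))

theorem isOmegaOct_uniform_iff {r n s : ℕ} (hr : r ≤ n) {J : Fin s → Fin n} {a b c d : Fin n} :
    (uniform r n).IsOmegaOct J a b c d ↔ s + 2 = r ∧ Function.Injective J ∧
      (∀ k, J k ≠ a ∧ J k ≠ b ∧ J k ≠ c ∧ J k ≠ d) ∧
      a ≠ b ∧ a ≠ c ∧ a ≠ d ∧ b ≠ c ∧ b ≠ d ∧ c ≠ d := by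
  constructor
  · intro h
    have hab := extend_injective_iff.1 h.ab.1
    have hcd := extend_injective_iff.1 h.cd.1
    exact ⟨((isBasisTuple_uniform_iff hr _).1 h.ab).2, hab.1,
      fun k => ⟨hab.2.1 k, hab.2.2.1 k, hcd.2.1 k, hcd.2.2.1 k⟩, hab.2.2.2,
      (extend_injective_iff.1 h.ac.1).2.2.2, (extend_injective_iff.1 h.ad.1).2.2.2,
      (extend_injective_iff.1 h.bc.1).2.2.2, (extend_injective_iff.1 h.bd.1).2.2.2, hcd.2.2.2⟩
  · rintro ⟨hs, hJ, hk, hab, hac, had, hbc, hbd, hcd⟩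
    have key {x y : Fin n} (hx : ∀ k, J k ≠ x) (hy : ∀ k, J k ≠ y) (hxy : x ≠ y) :
        (uniform r n).IsBasisTuple (extend J x y) :=
      (isBasisTuple_uniform_iff hr _).2 ⟨extend_injective_iff.2 ⟨hJ, hx, hy, hxy⟩, hs⟩
    have ha k := (hk k).1
    have hb k := (hk k).2.1
    have hc k := (hk k).2.2.1
    have hd k := (hk k).2.2.2
    exact ⟨⟨key ha hc hac, key ha hd had, key hb hc hbc, key hb hd hbd⟩, key ha hb hab,
      key hc hd hcd⟩

/-! ### Plücker coordinates over `𝕍` and their three-term relations -/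

/-- The exponents of the Plücker coordinates of a normalized `2 × 5` matrix over `𝕍`. -/
def pluckerExponent (S : Finset (Fin 5)) : ZMod 5 → ℤ :=
  -- The value at `{i, j}` with `1 ≤ i < j` is `y_j - y_i` for `y₁ = 0`, `y₂ = 1`, `y₃ = 1/x₄`, `y₄
  -- = 1/(x₂x₄)`. For example, `y₃ - y₂ = (1 - x₄)/x₄ = x₃x₀/x₄`. The pairs `{0, j}` and `{1, 2}`
  -- have value `1`.
  if S = {1, 3} then ![0, 0, 0, 0, -1] else
  if S = {1, 4} then ![0, 0, -1, 0, -1] else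
  if S = {2, 3} then ![1, 0, 0, 1, -1] else
  if S = {2, 4} then ![0, 0, -1, 1, -1] else
  if S = {3, 4} then ![0, 1, -1, 1, -1] else 0

/-- The Plücker coordinates of a normalized `2 × 5` matrix over `𝕍`. -/
def plucker (S : Finset (Fin 5)) : SignedMonomial := (1, Multiplicative.ofAdd (pluckerExponent S))

/-- The Plücker coordinates of the dual `3 × 5` matrix. -/
def dualPlucker (S : Finset (Fin 5)) : SignedMonomial :=
  -- The sign is that of the shuffle listing `S` and then its complement, as for the Plücker
  -- coordinates of an orthogonal complement.
  (∏ i ∈ S, ∏ j ∈ Sᶜ, if i < j then 1 else -1, Multiplicative.ofAdd (pluckerExponent Sᶜ))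

/-- The three factors by which a three-term relation of `𝕍` can be scaled such that one of the
terms becomes `-1`. -/
def scaleFactor (i : ZMod 5) : Fin 3 → SignedMonomial :=
  ![1, SignedMonomial.minusOne * (SignedMonomial.x i)⁻¹,
    SignedMonomial.minusOne * (SignedMonomial.x (i - 1) * SignedMonomial.x (i + 1))⁻¹]

set_option maxRecDepth 10000 in
set_option synthInstance.maxHeartbeats 200000 in
-- Reordering `a, b, c, d` permutes the three terms and rescales them so that the last is `-1`.
-- Ranging over the three possible factors instead of all units makes the existence claim a finite
-- search; the hypotheses are interleaved with the quantifiers to discard repetitions early.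
theorem plucker_relation : ∀ a b : Fin 5, a ≠ b → ∀ c, a ≠ c → b ≠ c → ∀ d, a ≠ d → b ≠ d → c ≠ d →
    ∃ (i : ZMod 5) (k : Fin 3),
      formalSum
        (tupleValue plucker ![a, c] * tupleValue plucker ![b, d] /
          (tupleValue plucker ![a, d] * tupleValue plucker ![b, c]))
        (tupleValue plucker ![a, b] * tupleValue plucker ![c, d] /
          (tupleValue plucker ![a, d] * tupleValue plucker ![c, b])) SignedMonomial.minusOne =
      (formalSum (SignedMonomial.x i) (SignedMonomial.x (i - 1) * SignedMonomial.x (i + 1))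
        SignedMonomial.minusOne).map (fun g => scaleFactor i k * g) := by
  decide +kernel

set_option maxRecDepth 10000 in
set_option synthInstance.maxHeartbeats 200000 in
theorem dualPlucker_relation : ∀ j a : Fin 5, j ≠ a → ∀ b, j ≠ b → a ≠ b →
    ∀ c, j ≠ c → a ≠ c → b ≠ c → ∀ d, j ≠ d → a ≠ d → b ≠ d → c ≠ d →
    ∃ (i : ZMod 5) (k : Fin 3),
      formalSum
        (tupleValue dualPlucker ![j, a, c] * tupleValue dualPlucker ![j, b, d] /
          (tupleValue dualPlucker ![j, a, d] * tupleValue dualPlucker ![j, b, c]))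
        (tupleValue dualPlucker ![j, a, b] * tupleValue dualPlucker ![j, c, d] /
          (tupleValue dualPlucker ![j, a, d] * tupleValue dualPlucker ![j, c, b]))
        SignedMonomial.minusOne =
      (formalSum (SignedMonomial.x i) (SignedMonomial.x (i - 1) * SignedMonomial.x (i + 1))
        SignedMonomial.minusOne).map (fun g => scaleFactor i k * g) := by
  decide +kernel

set_option synthInstance.maxHeartbeats 200000 in
-- The relation indexed by `i` comes from the four elements other than `i`, in the order `i + 1, i +
-- 2, i + 4, i + 3`.
theorem plucker_crossRatio : ∀ i : Fin 5,
    tupleValue plucker ![i + 1, i + 4] * tupleValue plucker ![i + 2, i + 3] /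
      (tupleValue plucker ![i + 1, i + 3] * tupleValue plucker ![i + 2, i + 4])
        = SignedMonomial.x (i : ℕ) ∧
    tupleValue plucker ![i + 1, i + 2] * tupleValue plucker ![i + 4, i + 3] /
      (tupleValue plucker ![i + 1, i + 3] * tupleValue plucker ![i + 4, i + 2])
        = SignedMonomial.x ((i : ℕ) - 1) * SignedMonomial.x ((i : ℕ) + 1) := by
  decide +kernel

set_option synthInstance.maxHeartbeats 200000 in
theorem dualPlucker_crossRatio : ∀ i : Fin 5,
    tupleValue dualPlucker ![i, i + 1, i + 4] * tupleValue dualPlucker ![i, i + 2, i + 3] /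
      (tupleValue dualPlucker ![i, i + 1, i + 3] * tupleValue dualPlucker ![i, i + 2, i + 4])
        = SignedMonomial.x (i : ℕ) ∧
    tupleValue dualPlucker ![i, i + 1, i + 2] * tupleValue dualPlucker ![i, i + 4, i + 3] /
      (tupleValue dualPlucker ![i, i + 1, i + 3] * tupleValue dualPlucker ![i, i + 4, i + 2])
        = SignedMonomial.x ((i : ℕ) - 1) * SignedMonomial.x ((i : ℕ) + 1) := by
  decide +kernel

theorem extend_of_length_zero (J : Fin 0 → Fin 5) (a b : Fin 5) : extend J a b = ![a, b] := by
  ext k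
  fin_cases k <;> rfl

theorem extend_of_length_one (J : Fin 1 → Fin 5) (a b : Fin 5) : extend J a b = ![J 0, a, b] := by
  ext k
  fin_cases k <;> rfl

/-! ### The linear system for the ten coordinates -/

/-- The pairs in `Fin 5`. -/
def sortedPairs : Fin 10 → Fin 2 → Fin 5 :=
  ![![0, 1], ![0, 2], ![0, 3], ![0, 4], ![1, 2], ![1, 3], ![1, 4], ![2, 3], ![2, 4], ![3, 4]]

/-- The complements of the pairs in `Fin 5`. -/
def sortedTriples : Fin 10 → Fin 3 → Fin 5 :=
  ![![2, 3, 4], ![1, 3, 4], ![1, 2, 4], ![1, 2, 3], ![0, 3, 4], ![0, 2, 4], ![0, 2, 3],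
    ![0, 1, 4], ![0, 1, 3], ![0, 1, 2]]

/-- The exponents of the Plücker coordinates as a table. -/
def exponentTable : Fin 10 → Fin 5 → ℤ :=
  ![![0, 0, 0, 0, 0], ![0, 0, 0, 0, 0], ![0, 0, 0, 0, 0], ![0, 0, 0, 0, 0], ![0, 0, 0, 0, 0],
    ![0, 0, 0, 0, -1], ![0, 0, -1, 0, -1], ![1, 0, 0, 1, -1], ![0, 0, -1, 1, -1],
    ![0, 1, -1, 1, -1]]

/-- The indicator vectors of the pairs in `Fin 5`. -/
def pairIndicator : Fin 10 → Fin 5 → ℤ :=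
  ![![1, 1, 0, 0, 0], ![1, 0, 1, 0, 0], ![1, 0, 0, 1, 0], ![1, 0, 0, 0, 1], ![0, 1, 1, 0, 0],
    ![0, 1, 0, 1, 0], ![0, 1, 0, 0, 1], ![0, 0, 1, 1, 0], ![0, 0, 1, 0, 1], ![0, 0, 0, 1, 1]]

/-- The exponent equations kill the coefficients of the five pairs with nontrivial coordinate. The
other pairs form a triangle on `0, 1, 2` with edges from `0` to `3` and `4`; as the cycle is odd,
their indicator vectors are linearly independent. -/
theorem eq_zero_of_exponents_of_multidegree (v : Fin 10 → ℤ)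
    (hp : ∀ i, ∑ k, v k * exponentTable k i = 0) (hd : ∀ j, ∑ k, v k * pairIndicator k j = 0) :
    ∀ k, v k = 0 := by
  simp only [Fin.sum_univ_succ, Fin.forall_fin_succ, exponentTable, pairIndicator] at hp hd ⊢
  simp at hp hd ⊢
  omega

theorem innerValue_plucker_injective :
    Function.Injective (innerValue (r := 2) (by norm_num) plucker) := by
  refine innerValue_injective _ _ sortedPairs (by decide) ?_ ?_
  · intro I hI
    have h : I 0 < I 1 := hI (by decide)
    have hI : I = ![I 0, I 1] := by ext k; fin_cases k <;> rfl
    rw [hI]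
    generalize I 0 = a at h ⊢
    generalize I 1 = b at h ⊢
    revert a b
    decide
  · intro v hp hd
    have he : ∀ (k : Fin 10) (i : Fin 5),
        (plucker (Finset.univ.image (sortedPairs k))).2.toAdd (i : ℕ) = exponentTable k i := by
      change ∀ (k : Fin 10) (i : Fin 5),
        pluckerExponent (Finset.univ.image (sortedPairs k)) (i : ℕ) = exponentTable k i
      decide +kernel
    have hi : ∀ k j, (∑ l, if sortedPairs k l = j then (1 : ℤ) else 0) = pairIndicator k j := by
      decide +kernel
    simp only [hi] at hd
    exact eq_zero_of_exponents_of_multidegree v (fun i => by simpa only [he] using hp (i : ℕ)) hd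

theorem innerValue_dualPlucker_injective :
    Function.Injective (innerValue (r := 3) (by norm_num) dualPlucker) := by
  refine innerValue_injective _ _ sortedTriples (by decide) ?_ ?_
  · intro I hI
    have h : I 0 < I 1 := hI (by decide)
    have h' : I 1 < I 2 := hI (by decide)
    have hI : I = ![I 0, I 1, I 2] := by ext k; fin_cases k <;> rfl
    rw [hI]
    generalize I 0 = a at h ⊢
    generalize I 1 = b at h h' ⊢
    generalize I 2 = c at h' ⊢
    revert a b c
    decide
  · intro v hp hd
    have he : ∀ (k : Fin 10) (i : Fin 5),
        (dualPlucker (Finset.univ.image (sortedTriples k))).2.toAdd (i : ℕ) = exponentTable k i := by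
      change ∀ (k : Fin 10) (i : Fin 5),
        pluckerExponent (Finset.univ.image (sortedTriples k))ᶜ (i : ℕ) = exponentTable k i
      decide +kernel
    have hi : ∀ k j, (∑ l, if sortedTriples k l = j then (1 : ℤ) else 0)
        = 1 - pairIndicator k j := by
      decide +kernel
    -- Summing the degree equations over `j` gives `3 ∑ v k = 0`, since each triple has three
    -- elements. With `∑ v k = 0`, complementary indicators impose the same equations as those of
    -- the pairs.
    have hs : ∀ k, ∑ j, (1 - pairIndicator k j) = 3 := by decide
    simp only [hi] at hd
    have hv : ∑ k, v k = 0 := by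
      have h3 : ∑ j, ∑ k, v k * (1 - pairIndicator k j) = 0 := Finset.sum_eq_zero fun j _ => hd j
      rw [Finset.sum_comm] at h3
      simp only [← Finset.mul_sum, hs, ← Finset.sum_mul] at h3
      omega
    refine eq_zero_of_exponents_of_multidegree v (fun i => by simpa only [he] using hp (i : ℕ)) fun j => ?_
    have h4 := hd j
    simp only [mul_sub, mul_one, Finset.sum_sub_distrib, hv] at h4
    omega

/-! ### The two foundations -/

theorem nonempty_foundation_uniform_two_five_iso :
    Nonempty ((uniform 2 5).foundation ≅ Pasture.V) := by
  refine nonempty_foundation_iso_V (by norm_num) plucker innerValue_plucker_injective ?_ ?_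
  · intro s J a b c d h
    obtain ⟨hs, -, -, hab, hac, had, hbc, hbd, hcd⟩ :=
      (isOmegaOct_uniform_iff (by norm_num)).1 h
    obtain rfl : s = 0 := by omega
    simp only [extend_of_length_zero]
    obtain ⟨i, k, h⟩ := plucker_relation a b hab c hac hbc d had hbd hcd
    exact ⟨i, _, h⟩
  · intro i'
    obtain ⟨i, rfl⟩ : ∃ i : Fin 5, ((i : ℕ) : ZMod 5) = i' :=
      ⟨⟨i'.val, ZMod.val_lt i'⟩, ZMod.natCast_zmod_val i'⟩
    refine ⟨0, ![], i + 1, i + 2, i + 4, i + 3, ?_⟩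
    simp only [extend_of_length_zero, isOmegaOct_uniform_iff (r := 2) (n := 5) (by norm_num)]
    refine ⟨?_, ?_, plucker_crossRatio i⟩
    all_goals
      revert i
      decide

theorem nonempty_foundation_uniform_three_five_iso :
    Nonempty ((uniform 3 5).foundation ≅ Pasture.V) := by
  refine nonempty_foundation_iso_V (by norm_num) dualPlucker innerValue_dualPlucker_injective ?_ ?_
  · intro s J a b c d h
    obtain ⟨hs, -, hJ, hab, hac, had, hbc, hbd, hcd⟩ :=
      (isOmegaOct_uniform_iff (by norm_num)).1 h
    obtain rfl : s = 1 := by omega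
    simp only [extend_of_length_one]
    obtain ⟨ha, hb, hc, hd⟩ := hJ 0
    obtain ⟨i, k, h⟩ :=
      dualPlucker_relation (J 0) a ha b hb hab c hc hac hbc d hd had hbd hcd
    exact ⟨i, _, h⟩
  · intro i'
    obtain ⟨i, rfl⟩ : ∃ i : Fin 5, ((i : ℕ) : ZMod 5) = i' :=
      ⟨⟨i'.val, ZMod.val_lt i'⟩, ZMod.natCast_zmod_val i'⟩
    refine ⟨1, ![i], i + 1, i + 2, i + 4, i + 3, ?_⟩
    simp only [extend_of_length_one, isOmegaOct_uniform_iff (r := 3) (n := 5) (by norm_num)]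
    refine ⟨?_, ?_, dualPlucker_crossRatio i⟩
    all_goals
      revert i
      decide

end Matroid

theorem mainTheorem12 :
    Nonempty ((Matroid.uniform 2 5).foundation ≅ Pasture.V) ∧
      Nonempty ((Matroid.uniform 3 5).foundation ≅ Pasture.V) :=
  ⟨Matroid.nonempty_foundation_uniform_two_five_iso,
    Matroid.nonempty_foundation_uniform_three_five_iso⟩
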